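/- **Theorem (GP limit of the CPD-constrained kernel machine).** Let $D\ge 1$ and, for $d=1,\dots,D$, let $M_d\in\mathbb{N}$, let $\varphi^{(d)}:\mathbb{R}\to\mathbb{R}^{M_d}$ be arbitrary functions and let $\Lambda^{(d)}\in\mathbb{R}^{M_d\times M_d}$. For $R\ge 1$ and matrices $W^{(d)}\in\mathbb{R}^{M_d\times R}$ (the cores, with columns $w^{(d)}_{:,r}$ and entries $w^{(d)}_{m,r}$), the CPD-constrained kernel machine is $$f_{\mathrm{CPD}}(x)=\sum_{m_1=1}^{M_1}\cdots\sum_{m_D=1}^{M_D}\Big(\prod_{d=1}^D\varphi^{(d)}_{m_d}(x_d)\Big)\Big(\sum_{r=1}^R\prod_{d=1}^D w^{(d)}_{m_d,r}\Big)=\sum_{r=1}^R\prod_{d=1}^D\varphi^{(d)}(x_d)^{\mathrm T}w^{(d)}_{:,r},\qquad x\in\mathbb{R}^D.$$ Suppose that for every $R\ge 1$ the cores are random, with square-integrable entries, such that all the columns $w^{(d)}_{:,r}$ ($1\le d\le D$, $1\le r\le R$) are independent, for each $d$ the columns $w^{(d)}_{:,1},\dots,w^{(d)}_{:,R}$ are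 identically distributed, and $$\mathbb{E}\big[w^{(d)}_{:,r}\big]=0,\qquad \mathbb{E}\big[w^{(d)}_{:,r}{w^{(d)}_{:,r}}^{\mathrm T}\big]=R^{-1/D}\Lambda^{(d)},$$ where the prior depends on $R$ only through this scaling, that is, for each $d$ the law of $R^{1/(2D)}w^{(d)}_{:,r}$ is the same for all $R$ (and $r$). Then, as $R\to\infty$, $f_{\mathrm{CPD}}$ converges in distribution to the zero-mean Gaussian process on $\mathbb{R}^D$ with covariance function $$k(x,x')=\prod_{d=1}^D\varphi^{(d)}(x_d)^{\mathrm T}\Lambda^{(d)}\varphi^{(d)}(x'_d),$$ in the sense that for all $N$ and all $x_1,\dots,x_N\in\mathbb{R}^D$ the random vector $(f_{\mathrm{CPD}}(x_1),\dots,f_{\mathrm{CPD}}(x_N))$ converges in distribution to $\mathcal{N}\big(0,(k(x_i,x_j))_{i,j}\big)$. -/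

import Mathlib

open MeasureTheory ProbabilityTheory Filter
open scoped BigOperators

/-- The real tensors of size `M 0 × M 1 × ⋯ × M (D - 1)`, indexed by multi-indices. -/
abbrev RealTensor {D : ℕ} (M : Fin D → ℕ) : Type :=
  ((d : Fin D) → Fin (M d)) → ℝ

/-- The Frobenius inner product of two tensors. -/
def frobInner {D : ℕ} {M : Fin D → ℕ} (V W : RealTensor M) : ℝ :=
  ∑ m : (d : Fin D) → Fin (M d), V m * W m

/-- The rank-one tensor `v 0 ⊗ v 1 ⊗ ⋯ ⊗ v (D - 1)`. -/
def rankOneTensor {D : ℕ} {M : Fin D → ℕ} (v : (d : Fin D) → Fin (M d) → ℝ) :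
    RealTensor M :=
  fun m => ∏ d : Fin D, v d (m d)

/-- The tensor with rank-`R` canonical polyadic decomposition given by the core matrices `W d`. -/
def cpdTensor {D R : ℕ} {M : Fin D → ℕ}
    (W : (d : Fin D) → Matrix (Fin (M d)) (Fin R) ℝ) : RealTensor M :=
  fun m => ∑ r : Fin R, ∏ d : Fin D, W d (m d) r

/-- The CPD-constrained kernel machine with basis functions `φ d : ℝ → ℝ ^ (M d)` and cores `W d`,
evaluated at `x`. -/
def fCPD {D R : ℕ} {M : Fin D → ℕ} (φ : (d : Fin D) → ℝ → Fin (M d) → ℝ)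
    (W : (d : Fin D) → Matrix (Fin (M d)) (Fin R) ℝ) (x : Fin D → ℝ) : ℝ :=
  frobInner (rankOneTensor fun d => φ d (x d)) (cpdTensor W)

/-- The kernel machine as the sum over the `R` components of the products of the
inner products of basis functions and core columns. -/
theorem fCPD_eq_sum_prod {D R : ℕ} {M : Fin D → ℕ} (φ : (d : Fin D) → ℝ → Fin (M d) → ℝ)
    (W : (d : Fin D) → Matrix (Fin (M d)) (Fin R) ℝ) (x : Fin D → ℝ) :
    fCPD φ W x = ∑ r : Fin R, ∏ d : Fin D, φ d (x d) ⬝ᵥ (W d).col r := by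
  simp only [fCPD, frobInner, rankOneTensor, cpdTensor, dotProduct, Matrix.col_apply,
    Finset.prod_univ_sum, Fintype.piFinset_univ, Finset.mul_sum, Finset.prod_mul_distrib]
  exact Finset.sum_comm

/-- The product kernel `∏ d, φ d (x d)ᵀ * Λ d * φ d (x' d)`. -/
def productKernel {D : ℕ} {M : Fin D → ℕ} (φ : (d : Fin D) → ℝ → Fin (M d) → ℝ)
    (Λ : (d : Fin D) → Matrix (Fin (M d)) (Fin (M d)) ℝ) (x x' : Fin D → ℝ) : ℝ :=
  ∏ d : Fin D, φ d (x d) ⬝ᵥ (Λ d).mulVec (φ d (x' d))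

/-- `Z` is a Gaussian process with mean function `μ` and covariance function `k`. -/
structure IsGPWith {T Ω : Type*} [MeasurableSpace Ω] (Z : T → Ω → ℝ) (P : Measure Ω)
    (μ : T → ℝ) (k : T → T → ℝ) : Prop where
  gaussian : IsGaussianProcess Z P
  mean : ∀ t, ∫ ω, Z t ω ∂P = μ t
  covariance : ∀ s t, cov[Z s, Z t; P] = k s t

/-- Convergence of the finite-dimensional distributions of the processes `X n` (which may live on
different probability spaces) to those of the process `Z`, as `n → ∞`. -/
def TendstoFDD {T Ω' : Type*} {Ω : ℕ → Type*} [∀ n, MeasurableSpace (Ω n)] [MeasurableSpace Ω']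
    (X : (n : ℕ) → T → Ω n → ℝ) (Z : T → Ω' → ℝ) (P : (n : ℕ) → Measure (Ω n))
    [∀ n, IsProbabilityMeasure (P n)] (P' : Measure Ω') [IsProbabilityMeasure P'] : Prop :=
  ∀ (N : ℕ) (t : Fin N → T),
    TendstoInDistribution (fun n (ω : Ω n) (i : Fin N) => X n (t i) ω) atTop
      (fun (ω : Ω') (i : Fin N) => Z (t i) ω) P P'

/-! The scaling `R ^ (-1 / (2 * D))` of each of the `D` columns multiplies up to `R ^ (-1 / 2)`, so
the weight tensor is `(√R)⁻¹` times a sum of `R` i.i.d. rank-one tensors whose common law does not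
depend on `R` (`cpdTensor_eq_inv_sqrt_smul_sum`). Independence across `d` makes these tensors square
integrable and centered, with covariance the Kronecker product of the `Λ d`. The multivariate
central limit theorem `tendstoInDistribution_inv_sqrt_smul_sum` then gives a Gaussian limit tensor
`g`. Evaluation at `x` is the inner product with the feature tensor of `x`, a continuous linear
functional. Hence the limit process is `x ↦ ⟨Φ x, g⟩`, and its covariance factors into
`productKernel` because `Φ x` has rank one. -/

/-- If `X` is centered and square integrable, the `n`-th power of its characteristic function at
`t / √n` tends to the characteristic function of the Gaussian with the same variance. -/
theorem tendsto_charFun_inv_sqrt_mul_pow_variance {Ω : Type*} [MeasurableSpace Ω] {P : Measure Ω}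
    [IsProbabilityMeasure P] {X : Ω → ℝ} (hX : MemLp X 2 P) (h0 : P[X] = 0) (t : ℝ) :
    Tendsto (fun n : ℕ => charFun (P.map X) ((√n)⁻¹ * t) ^ n) atTop
      (nhds (Complex.exp (-(Var[X; P] * t ^ 2 : ℝ) / 2))) := by
  have hm : AEMeasurable X P := hX.aestronglyMeasurable.aemeasurable
  obtain h | h := eq_or_ne Var[X; P] 0
  -- In the degenerate case `X = 0` almost surely, and both sides are constantly `1`.
  · have hae : X =ᵐ[P] fun _ => 0 := by
      simpa [h0, Filter.EventuallyEq] using ae_eq_integral_of_variance_eq_zero hX h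
    simp [Measure.map_congr hae, h]
  · have hpos : 0 < Var[X; P] := (variance_nonneg X P).lt_of_ne' h
    have hsq : √Var[X; P] ≠ 0 := (Real.sqrt_pos.2 hpos).ne'
    have key := tendsto_charFun_inv_sqrt_mul_pow (X := fun ω => (√Var[X; P])⁻¹ * X ω)
      (hm.const_mul _) (by rw [integral_const_mul, h0, mul_zero])
      (by
        simp only [Pi.pow_apply, mul_pow, inv_pow]
        rw [integral_const_mul, Real.sq_sqrt hpos.le, ← variance_of_integral_eq_zero hm h0,
          inv_mul_cancel₀ h])
      (√Var[X; P] * t)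
    convert key using 2 with n
    · rw [charFun_map_mul_comp hm]
      congr 2
      field_simp
    · rw [← Complex.ofReal_pow, mul_pow, Real.sq_sqrt hpos.le]

/-- **Multivariate central limit theorem** for a triangular array whose rows are i.i.d. with a
common law `μ`, where the rows may live on different probability spaces. -/
theorem tendstoInDistribution_inv_sqrt_smul_sum {E : Type*} [NormedAddCommGroup E]
    [InnerProductSpace ℝ E] [FiniteDimensional ℝ E] [MeasurableSpace E] [BorelSpace E]
    {μ γ : Measure E} [IsProbabilityMeasure μ] [IsGaussian γ] (hμ : MemLp id 2 μ)
    (hμ0 : μ[id] = 0) (hγ0 : γ[id] = 0)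
    (hcov : ∀ t, covarianceBilin γ t t = covarianceBilin μ t t)
    {Ω : ℕ → Type*} [∀ n, MeasurableSpace (Ω n)] {P : (n : ℕ) → Measure (Ω n)}
    [∀ n, IsProbabilityMeasure (P n)] {Y : (n : ℕ) → Fin n → Ω n → E}
    (hindep : ∀ n, iIndepFun (Y n) (P n)) (hlaw : ∀ n i, HasLaw (Y n i) μ (P n)) :
    TendstoInDistribution (fun (n : ℕ) ω => (√n)⁻¹ • ∑ i, Y n i ω) atTop id P γ := by
  have hmY : ∀ n i, AEMeasurable (Y n i) (P n) := fun n i => (hlaw n i).aemeasurable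
  have hm : ∀ n, AEMeasurable (fun ω => ∑ i, Y n i ω) (P n) := fun n =>
    Finset.aemeasurable_fun_sum _ fun i _ => hmY n i
  refine ⟨fun n => (hm n).const_smul _, aemeasurable_id, ?_⟩
  refine ProbabilityMeasure.tendsto_iff_tendsto_charFun.2 fun t => ?_
  -- By independence the characteristic function depends on `μ` alone, so the rows need no common
  -- space. At `t` it reduces to the scalar variable `⟨t, x⟩`.
  have hchar : ∀ n : ℕ, charFun ((P n).map fun ω => (√n)⁻¹ • ∑ i, Y n i ω) t =
      charFun (μ.map fun x => inner ℝ t x) ((√n)⁻¹ * 1) ^ n := by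
    intro n
    rw [charFun_map_smul_comp (hm n), (hindep n).charFun_map_fun_sum_eq_prod (hmY n)]
    simp only [(hlaw n _).map_eq, Finset.prod_const, Finset.card_univ, Fintype.card_fin,
      Finset.prod_apply]
    congr 1
    rw [charFun_apply, charFun_apply, integral_map (by fun_prop) (by fun_prop)]
    simp [inner_smul_right, real_inner_comm]
  have hmean : μ[fun x => inner ℝ t x] = 0 := by
    have := integral_inner (𝕜 := ℝ) (hμ.integrable one_le_two) t
    rwa [hμ0, inner_zero_right] at this
  have key := tendsto_charFun_inv_sqrt_mul_pow_variance (hμ.const_inner t) hmean 1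
  simp only [ProbabilityMeasure.coe_mk, Measure.map_id, hchar]
  rw [IsGaussian.charFun_eq', hγ0, hcov, covarianceBilin_self hμ]
  simpa [neg_div] using key

/-- If a finite family indexed by pairs is independent, then so are the families of its rows. -/
theorem iIndepFun_curry {ι κ Ω : Type*} [Finite ι] [Finite κ] [MeasurableSpace Ω] {P : Measure Ω}
    {β : ι → Type*} [∀ i, MeasurableSpace (β i)] {X : (i : ι) → κ → Ω → β i}
    (hX : ∀ i j, AEMeasurable (X i j) P)
    (h : iIndepFun (fun (p : ι × κ) ω => X p.1 p.2 ω) P) :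
    iIndepFun (fun (j : κ) ω (i : ι) => X i j ω) P := by
  have := h.isProbabilityMeasure
  have hprob : ∀ (j : κ) (i : ι), IsProbabilityMeasure (P.map (X i j)) :=
    fun j i => Measure.isProbabilityMeasure_map (hX i j)
  have hrow : ∀ j, AEMeasurable (fun ω (i : ι) => X i j ω) P :=
    fun j => aemeasurable_pi_lambda _ fun i => hX i j
  have hprob' : ∀ j, IsProbabilityMeasure (P.map fun ω (i : ι) => X i j ω) :=
    fun j => Measure.isProbabilityMeasure_map (hrow j)
  have hsig : iIndepFun (fun (p : (_ : κ) × ι) ω => X p.2 p.1 ω) P :=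
    h.precomp (g := fun p : (_ : κ) × ι => (p.2, p.1)) fun p q hpq => by
      cases p; cases q; simp_all
  have hone : ∀ j, iIndepFun (fun (i : ι) ω => X i j ω) P := fun j =>
    h.precomp (g := fun i => (i, j)) fun p q hpq => by simp_all
  have hcomp : (MeasurableEquiv.piCurry fun (_ : κ) (i : ι) => β i) ∘
      (fun ω (p : (_ : κ) × ι) => X p.2 p.1 ω) = fun ω j i => X i j ω := by
    ext; simp [Sigma.curry]
  have hmsig : ∀ p : (_ : κ) × ι, AEMeasurable (fun ω => X p.2 p.1 ω) P := fun p => hX _ _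
  -- Independence says that the joint law is a product; currying turns a product over pairs into a
  -- product of row products.
  rw [iIndepFun_iff_map_fun_eq_infinitePi_map₀' hrow, ← hcomp,
    ← AEMeasurable.map_map_of_aemeasurable (by fun_prop) (aemeasurable_pi_lambda _ hmsig),
    (iIndepFun_iff_map_fun_eq_infinitePi_map₀' hmsig).1 hsig,
    Measure.infinitePi_map_piCurry (fun (j : κ) (i : ι) => P.map (X i j))]
  congr 1
  funext j
  exact ((iIndepFun_iff_map_fun_eq_infinitePi_map₀' fun i => hX i j).1 (hone j)).symm

/-- A finite product of independent square integrable random variables is square integrable. -/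
theorem memLp_two_prod_of_iIndepFun {ι Ω : Type*} [Fintype ι] [MeasurableSpace Ω] {P : Measure Ω}
    {X : ι → Ω → ℝ} (h : iIndepFun X P) (hX : ∀ i, MemLp (X i) 2 P) :
    MemLp (fun ω => ∏ i, X i ω) 2 P := by
  have := h.isProbabilityMeasure
  have hm : ∀ i, AEMeasurable (X i) P := fun i => (hX i).aestronglyMeasurable.aemeasurable
  have hmp : AEMeasurable (fun ω i => X i ω) P := aemeasurable_pi_lambda _ hm
  have hprob : ∀ i, IsProbabilityMeasure (P.map (X i)) :=
    fun i => Measure.isProbabilityMeasure_map (hm i)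
  rw [memLp_two_iff_integrable_sq (by fun_prop)]
  have hi : Integrable (fun x : ι → ℝ => ∏ i, x i ^ 2) (P.map fun ω i => X i ω) := by
    rw [h.map_fun_eq_pi_map hm]
    refine Integrable.fintype_prod (f := fun _ x => x ^ 2) fun i => ?_
    rw [integrable_map_measure (by fun_prop) (hm i)]
    exact (hX i).integrable_sq
  simpa [Function.comp_def, Finset.prod_pow] using hi.comp_aemeasurable hmp

/-- Inner products with a centered Gaussian vector form a Gaussian process. -/
theorem isGPWith_inner_multivariateGaussian {T ι : Type*} [Fintype ι] [DecidableEq ι]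
    {S : Matrix ι ι ℝ} (hS : S.PosSemidef) (v : T → EuclideanSpace ℝ ι) :
    IsGPWith (fun t g => inner ℝ (v t) g) (multivariateGaussian 0 S) (fun _ => 0)
      (fun s t => (v s).ofLp ⬝ᵥ S.mulVec (v t).ofLp) where
  gaussian := ⟨fun I =>
    (IsGaussian.hasGaussianLaw_id (μ := multivariateGaussian 0 S)).map
      (ContinuousLinearMap.pi fun t : I => innerSL ℝ (v t))⟩
  mean t := by
    rw [integral_inner IsGaussian.integrable_fun_id]
    simp
  covariance s t := by
    rw [← covarianceBilin_apply_eq_cov IsGaussian.memLp_two_id,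
      covarianceBilin_multivariateGaussian hS]

/-- The covariance bilinear form of the law of a random vector is given by its covariance
matrix. -/
theorem covarianceBilin_map_toLp {ι Ω : Type*} [Fintype ι] [MeasurableSpace Ω] {P : Measure Ω}
    [IsFiniteMeasure P] {X : ι → Ω → ℝ} (hX : ∀ i, MemLp (X i) 2 P) (x y : EuclideanSpace ℝ ι) :
    covarianceBilin (P.map fun ω => WithLp.toLp 2 (X · ω)) x y =
      x.ofLp ⬝ᵥ (Matrix.of fun i j => cov[X i, X j; P]).mulVec y.ofLp := by
  rw [covarianceBilin_apply_pi hX]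
  simp only [dotProduct, Matrix.mulVec, Matrix.of_apply, Finset.mul_sum]
  exact Finset.sum_congr rfl fun i _ => Finset.sum_congr rfl fun j _ => by ring

/-- The quadratic form of the matrix is the covariance form of the law of `X`. This replaces any
positivity assumption on the `Λ d`. -/
theorem posSemidef_covariance {ι Ω : Type*} [Fintype ι] [MeasurableSpace Ω] {P : Measure Ω}
    [IsFiniteMeasure P] {X : ι → Ω → ℝ} (hX : ∀ i, MemLp (X i) 2 P) :
    (Matrix.of fun i j => cov[X i, X j; P]).PosSemidef := by
  refine .of_dotProduct_mulVec_nonneg ?_ fun x => ?_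
  · ext i j
    simp [covariance_comm]
  · have := covarianceBilin_self_nonneg (μ := P.map fun ω => WithLp.toLp 2 (X · ω))
      (WithLp.toLp 2 x)
    rwa [covarianceBilin_map_toLp hX] at this

theorem memLp_id_map_toLp {ι Ω : Type*} [Fintype ι] [MeasurableSpace Ω] {P : Measure Ω}
    {X : ι → Ω → ℝ} (hX : ∀ i, MemLp (X i) 2 P) :
    MemLp id 2 (P.map fun ω => WithLp.toLp 2 (X · ω)) := by
  have hm : ∀ i, AEMeasurable (X i) P := fun i => (hX i).aestronglyMeasurable.aemeasurable
  rw [memLp_map_measure_iff (by fun_prop) (by fun_prop)]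
  exact MemLp.of_eval_piLp hX

/-- The product kernel is the bilinear form of the Kronecker product of the `Λ d`, evaluated at
the rank-one feature tensors. -/
theorem productKernel_eq_dotProduct {D : ℕ} {M : Fin D → ℕ} (φ : (d : Fin D) → ℝ → Fin (M d) → ℝ)
    (Λ : (d : Fin D) → Matrix (Fin (M d)) (Fin (M d)) ℝ) (x x' : Fin D → ℝ) :
    productKernel φ Λ x x' =
      (rankOneTensor fun d => φ d (x d)) ⬝ᵥ
        (Matrix.of fun m m' : (d : Fin D) → Fin (M d) => ∏ d, Λ d (m d) (m' d)).mulVec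
          (rankOneTensor fun d => φ d (x' d)) := by
  simp only [productKernel, dotProduct, Matrix.mulVec, rankOneTensor, Matrix.of_apply,
    Finset.prod_univ_sum, Fintype.piFinset_univ, Finset.prod_mul_distrib]

theorem frobInner_eq_inner {D : ℕ} {M : Fin D → ℕ} (V : RealTensor M)
    (g : EuclideanSpace ℝ ((d : Fin D) → Fin (M d))) :
    frobInner V g.ofLp = inner ℝ (WithLp.toLp 2 V) g := by
  simp [frobInner, PiLp.inner_apply, mul_comm]

theorem rankOneTensor_smul {D : ℕ} {M : Fin D → ℕ} (c : ℝ) (v : (d : Fin D) → Fin (M d) → ℝ) :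
    rankOneTensor (fun d => c • v d) = c ^ D • rankOneTensor v := by
  ext m
  simp [rankOneTensor, Finset.prod_mul_distrib]

theorem cpdTensor_eq_sum {D R : ℕ} {M : Fin D → ℕ}
    (W : (d : Fin D) → Matrix (Fin (M d)) (Fin R) ℝ) :
    cpdTensor W = ∑ r, rankOneTensor fun d => (W d).col r := by
  ext m
  simp [cpdTensor, rankOneTensor]

theorem rpow_inv_two_mul_pow {D : ℕ} (hD : 0 < D) (R : ℕ) :
    ((R : ℝ) ^ ((1 : ℝ) / (2 * (D : ℝ)))) ^ D = √R := by
  have : (D : ℝ) ≠ 0 := by positivity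
  rw [← Real.rpow_natCast, ← Real.rpow_mul (by positivity), Real.sqrt_eq_rpow]
  congr 1
  field_simp

/-- A kernel machine tensor as a normalized sum of rank-one tensors of rescaled columns. -/
theorem cpdTensor_eq_inv_sqrt_smul_sum {D R : ℕ} (hD : 0 < D) {M : Fin D → ℕ}
    (W : (d : Fin D) → Matrix (Fin (M d)) (Fin R) ℝ) :
    cpdTensor W = (√R)⁻¹ • ∑ r : Fin R,
      rankOneTensor fun d => (R : ℝ) ^ ((1 : ℝ) / (2 * (D : ℝ))) • (W d).col r := by
  simp only [rankOneTensor_smul, rpow_inv_two_mul_pow hD, ← Finset.smul_sum, ← cpdTensor_eq_sum]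
  -- For `R = 0` both sides are empty sums; otherwise `√R` cancels.
  obtain rfl | hR := R.eq_zero_or_pos
  · simp [cpdTensor_eq_sum]
  · rw [inv_smul_smul₀ (Real.sqrt_pos.2 (by exact_mod_cast hR)).ne']

theorem measurable_rankOneTensor {D : ℕ} {M : Fin D → ℕ} :
    Measurable (rankOneTensor (M := M)) := by
  unfold rankOneTensor
  fun_prop

theorem theorem1 {D : ℕ} (hD : 0 < D) (M : Fin D → ℕ)
    (φ : (d : Fin D) → ℝ → Fin (M d) → ℝ)
    (Λ : (d : Fin D) → Matrix (Fin (M d)) (Fin (M d)) ℝ)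
    -- for every rank `R`, random cores `W R d` on a probability space that may depend on `R`
    {Ω : ℕ → Type*} [∀ R, MeasurableSpace (Ω R)] (P : (R : ℕ) → Measure (Ω R))
    [∀ R, IsProbabilityMeasure (P R)]
    (W : (R : ℕ) → (d : Fin D) → Ω R → Matrix (Fin (M d)) (Fin R) ℝ)
    -- all columns of all cores are independent
    (hindep : ∀ R, iIndepFun
      (fun (p : Fin D × Fin R) (ω : Ω R) => ((W R p.1 ω).col p.2 : Fin (M p.1) → ℝ)) (P R))
    -- the columns of a core are identically distributed
    (hident : ∀ (R : ℕ) (d : Fin D) (r r' : Fin R),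
      IdentDistrib (fun ω : Ω R => (W R d ω).col r) (fun ω : Ω R => (W R d ω).col r')
        (P R) (P R))
    -- the law of a column depends on `R` only through the scaling by `R ^ (-1 / (2 * D))`
    (hscale : ∀ (d : Fin D) (R R' : ℕ) (r : Fin R) (r' : Fin R'),
      IdentDistrib
        (fun ω : Ω R => (R : ℝ) ^ ((1 : ℝ) / (2 * (D : ℝ))) • (W R d ω).col r)
        (fun ω : Ω R' => (R' : ℝ) ^ ((1 : ℝ) / (2 * (D : ℝ))) • (W R' d ω).col r')
        (P R) (P R'))
    -- first and second moments of the columns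
    (hL2 : ∀ (R : ℕ) (d : Fin D) (r : Fin R) (m : Fin (M d)),
      MemLp (fun ω => W R d ω m r) 2 (P R))
    (hmean : ∀ (R : ℕ) (d : Fin D) (r : Fin R) (m : Fin (M d)),
      ∫ ω, W R d ω m r ∂(P R) = 0)
    (hsecond : ∀ (R : ℕ) (d : Fin D) (r : Fin R) (m m' : Fin (M d)),
      ∫ ω, W R d ω m r * W R d ω m' r ∂(P R) = (R : ℝ) ^ (-(1 : ℝ) / (D : ℝ)) * Λ d m m') :
    ∃ (Ω' : Type) (_ : MeasurableSpace Ω') (P' : Measure Ω') (_ : IsProbabilityMeasure P')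
      (Z : (Fin D → ℝ) → Ω' → ℝ),
      IsGPWith Z P' (fun _ => 0) (productKernel φ Λ) ∧
      TendstoFDD (fun R x ω => fCPD φ (fun d => W R d ω) x) Z P P' := by
  set c : ℕ → ℝ := fun R => (R : ℝ) ^ ((1 : ℝ) / (2 * (D : ℝ))) with hc
  set X : (R : ℕ) → Fin R → (m : (d : Fin D) → Fin (M d)) → Ω R → ℝ :=
    fun R r m ω => rankOneTensor (fun d => c R • (W R d ω).col r) m with hXdef
  set Y : (R : ℕ) → Fin R → Ω R → EuclideanSpace ℝ ((d : Fin D) → Fin (M d)) :=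
    fun R r ω => WithLp.toLp 2 (X R r · ω) with hY
  have hcol : ∀ R d r, AEMeasurable (fun ω => (W R d ω).col r) (P R) :=
    fun R d r => (hident R d r r).aemeasurable_fst
  have hcolindep : ∀ R (r : Fin R), iIndepFun (fun d ω => (W R d ω).col r) (P R) := fun R r =>
    (hindep R).precomp (g := fun d => (d, r)) fun p q hpq => by simp_all
  have hmeasY : ∀ a : ℝ, Measurable fun v : (d : Fin D) → Fin (M d) → ℝ =>
      (WithLp.toLp 2 (rankOneTensor fun d => a • v d) :
        EuclideanSpace ℝ ((d : Fin D) → Fin (M d))) := fun a =>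
    (WithLp.measurable_toLp 2 _).comp (measurable_rankOneTensor.comp (by fun_prop))
  have hYindep : ∀ R, iIndepFun (Y R) (P R) := fun R =>
    (iIndepFun_curry (X := fun d r ω => (W R d ω).col r) (hcol R) (hindep R)).comp
      (fun _ v => WithLp.toLp 2 (rankOneTensor fun d => c R • v d)) fun _ => hmeasY _
  have hscaledindep : ∀ R (r : Fin R),
      iIndepFun (fun d ω => c R • (W R d ω).col r) (P R) := fun R r =>
    (hcolindep R r).comp (fun _ v => c R • v) fun _ => by fun_prop
  -- The column at `R = 1` serves as reference law: there the scaling factor is `1`, so all moments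
  -- are computed for `W 1`.
  have hYident : ∀ R (r : Fin R), IdentDistrib (Y R r) (Y 1 0) (P R) (P 1) := fun R r =>
    (IdentDistrib.pi (fun d => hscale d R 1 r 0) (hscaledindep R r) (hscaledindep 1 0)).comp
      ((WithLp.measurable_toLp 2 _).comp measurable_rankOneTensor)
  have hc1 : c 1 = 1 := by simp [hc]
  have hX1 : ∀ m ω, X 1 0 m ω = ∏ d, W 1 d ω (m d) 0 := by
    simp [hXdef, hc1, rankOneTensor]
  have hentry : ∀ m : (d : Fin D) → Fin (M d),
      iIndepFun (fun d ω => W 1 d ω (m d) 0) (P 1) := fun m =>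
    (hcolindep 1 0).comp (fun d v => v (m d)) fun d => by fun_prop
  have hX2 : ∀ m, MemLp (X 1 0 m) 2 (P 1) := fun m => by
    simpa only [← hX1] using memLp_two_prod_of_iIndepFun (hentry m) fun d => hL2 1 d 0 (m d)
  have hXmean : ∀ m, ∫ ω, X 1 0 m ω ∂(P 1) = 0 := fun m => by
    simp only [hX1]
    rw [(hentry m).integral_fun_prod_eq_prod_integral
      fun d => (hL2 1 d 0 (m d)).aestronglyMeasurable]
    -- A single vanishing factor suffices, and `0 < D` provides one.
    exact Finset.prod_eq_zero (Finset.mem_univ ⟨0, hD⟩) (hmean 1 _ 0 _)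
  have hXcov : ∀ m m', cov[X 1 0 m, X 1 0 m'; P 1] = ∏ d, Λ d (m d) (m' d) := fun m m' => by
    rw [covariance_eq_sub (hX2 m) (hX2 m'), hXmean, zero_mul, sub_zero]
    simp only [Pi.mul_apply, hX1, ← Finset.prod_mul_distrib]
    refine ((hcolindep 1 0).integral_fun_prod_comp (f := fun d v => v (m d) * v (m' d))
      (hcol 1 · 0) fun d => by fun_prop).trans ?_
    exact Finset.prod_congr rfl fun d _ => by simpa using hsecond 1 d 0 (m d) (m' d)
  set S : Matrix ((d : Fin D) → Fin (M d)) ((d : Fin D) → Fin (M d)) ℝ :=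
    Matrix.of fun m m' => ∏ d, Λ d (m d) (m' d) with hSdef
  have hScov : (Matrix.of fun m m' => cov[X 1 0 m, X 1 0 m'; P 1]) = S := by
    ext m m'
    exact hXcov m m'
  have hS : S.PosSemidef := hScov ▸ posSemidef_covariance hX2
  have hY1 : AEMeasurable (Y 1 0) (P 1) := (hYident 1 0).aemeasurable_fst
  have : IsProbabilityMeasure ((P 1).map (Y 1 0)) := Measure.isProbabilityMeasure_map hY1
  have hμ : MemLp id 2 ((P 1).map (Y 1 0)) := memLp_id_map_toLp hX2
  have hμ0 : ((P 1).map (Y 1 0))[id] = 0 := by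
    rw [integral_map hY1 (by fun_prop)]
    ext m
    simp only [id]
    rw [eval_integral_piLp fun m => (hX2 m).integrable one_le_two]
    exact hXmean m
  have hclt := tendstoInDistribution_inv_sqrt_smul_sum (γ := multivariateGaussian 0 S) hμ hμ0
    (by simp) (fun t => by
      rw [covarianceBilin_multivariateGaussian hS, covarianceBilin_map_toLp hX2, hScov]) hYindep
    fun R r => ⟨(hYident R r).aemeasurable_fst, (hYident R r).map_eq⟩
  refine ⟨EuclideanSpace ℝ ((d : Fin D) → Fin (M d)), inferInstance, multivariateGaussian 0 S,
    inferInstance, fun x g => inner ℝ (WithLp.toLp 2 (rankOneTensor fun d => φ d (x d))) g, ?_, ?_⟩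
  · have := isGPWith_inner_multivariateGaussian hS
      fun x : Fin D → ℝ => WithLp.toLp 2 (rankOneTensor fun d => φ d (x d))
    simpa only [← productKernel_eq_dotProduct, hSdef] using this
  · intro N x
    -- One limit theorem for tensors handles all points `x i` jointly, by continuous mapping.
    have hcont := hclt.continuous_comp
      (g := fun g (i : Fin N) =>
        (inner ℝ (WithLp.toLp 2 (rankOneTensor fun d => φ d (x i d))) g : ℝ)) (by fun_prop)
    refine hcont.congr (fun R => .of_forall fun ω => ?_) (.of_forall fun _ => rfl)
    funext i
    simp only [Function.comp, fCPD, cpdTensor_eq_inv_sqrt_smul_sum hD, ← frobInner_eq_inner]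
    congr 1
    ext m
    simp [hY, hXdef, hc]
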